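/- Consider the planar system $x'=\sin y$, $y'=-\sin x$, which is the Hamiltonian system $x'=G'(y)$, $y'=-F'(x)$ with $F(x)=1-\cos x$, $G(y)=1-\cos y$, $H(x,y)=F(x)+G(y)=2-\cos x-\cos y$. Put $$\begin{aligned}M(x,y)={}&\big[6F(x)F''(x)^2-3F'(x)^2F''(x)-2F(x)F'(x)F'''(x)\big]\,G(y)G'(y)^2\\&+F(x)F'(x)^2F''(x)\,\big[G'(y)^2-2G(y)G''(y)\big],\end{aligned}$$ $$N(x,y)=5+\cos(2x)-2(\cos x-2)\cos y,\qquad \Omega(2)=\{(x,y)\in\mathbb R^2: 0\le H(x,y)\le 2\}.$$ Let $\mathcal P$ be the period annulus of the origin, i.e. the largest open connected neighbourhood of $(0,0)$ which, apart from the origin, is entirely filled with (nonconstant) periodic orbits. Then: 1. The origin is a nondegenerate center ($F'(0)=G'(0)=0$, $F''(0),G''(0)>0$, and $\mathcal P$ exists). One has $H(\mathcal P)=[0,2)$ and $H=2$ on $\partial\mathcal P$. The boundary $\partial\mathcal P$ contains the four saddle points $(0,\pm\pi)$, $(\pm\pi,0)$, and every solution starting at any other point of $\partial\mathcal P$ tends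 to one of these saddles as $t\to-\infty$ and to a different one of them as $t\to+\infty$. 2. For every $E\in(0,2)$ the set $\mathcal P\cap\{H=E\}$ is a single periodic orbit; let $T(E)>0$ denote its minimal period. 3. For all $(x,y)\in\mathbb R^2$, $$M(x,y)=4(1-\cos y)\,\sin^4\!\big(\tfrac x2\big)\,\sin^2\!\big(\tfrac y2\big)\,N(x,y).$$ 4. $N(x,y)\ge 0$, and consequently $M(x,y)\ge 0$, for all $(x,y)\in\Omega(2)$. 5. The period function $T$ is monotonically increasing on $(0,2)$, that is, $T$ is differentiable with $T'(E)\ge 0$ for every $E\in(0,2)$. -/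

import Mathlib

namespace SeparableHamiltonian

/-- The separable Hamiltonian `H(x, y) = F(x) + G(y)`. -/
def hamiltonian (F G : ℝ → ℝ) (p : ℝ × ℝ) : ℝ := F p.1 + G p.2

/-- The sublevel region `Ω(E) = {(x, y) : 0 ≤ H(x, y) ≤ E}`. -/
def region (F G : ℝ → ℝ) (E : ℝ) : Set (ℝ × ℝ) :=
  {p | 0 ≤ hamiltonian F G p ∧ hamiltonian F G p ≤ E}

/-- The function
`M = [6 F F''² - 3 F'² F'' - 2 F F' F'''] G G'² + F F'² F'' [G'² - 2 G G'']`,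
with `F` and its derivatives taken at `x`, and `G` and its derivatives at `y`. -/
noncomputable def criterion (F G : ℝ → ℝ) (x y : ℝ) : ℝ :=
  (6 * F x * (iteratedDeriv 2 F x) ^ 2 - 3 * (deriv F x) ^ 2 * iteratedDeriv 2 F x
      - 2 * F x * deriv F x * iteratedDeriv 3 F x) * (G y * (deriv G y) ^ 2)
    + F x * (deriv F x) ^ 2 * iteratedDeriv 2 F x
      * ((deriv G y) ^ 2 - 2 * G y * iteratedDeriv 2 G y)

/-- `γ` is a solution, defined for all times, of `x' = G'(y)`, `y' = -F'(x)`. -/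
def IsSolution (F G : ℝ → ℝ) (γ : ℝ → ℝ × ℝ) : Prop :=
  ∀ t : ℝ, HasDerivAt (fun s => (γ s).1) (deriv G (γ t).2) t ∧
    HasDerivAt (fun s => (γ s).2) (-deriv F (γ t).1) t

/-- `O` is (the image of) a periodic orbit with minimal period `τ`. A constant solution has no
least positive period, so equilibria are not periodic orbits. -/
def IsPeriodicOrbit (F G : ℝ → ℝ) (O : Set (ℝ × ℝ)) (τ : ℝ) : Prop :=
  ∃ γ : ℝ → ℝ × ℝ, IsSolution F G γ ∧ Set.range γ = O ∧
    IsLeast {s : ℝ | 0 < s ∧ Function.Periodic γ s} τ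

/-- `U` is an open connected neighbourhood of the origin such that `U` without the origin is
entirely filled with periodic orbits (contained in `U`). -/
def IsFilledNeighborhood (F G : ℝ → ℝ) (U : Set (ℝ × ℝ)) : Prop :=
  IsOpen U ∧ IsConnected U ∧ (0, 0) ∈ U ∧
    ∀ p ∈ U, p ≠ (0, 0) → ∃ O τ, IsPeriodicOrbit F G O τ ∧ p ∈ O ∧ O ⊆ U

/-- The period annulus of the origin (with the origin included): the largest neighbourhood of the
origin filled with periodic orbits, that is, the union of all of them. -/
def periodAnnulus (F G : ℝ → ℝ) : Set (ℝ × ℝ) :=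
  ⋃₀ {U | IsFilledNeighborhood F G U}

/-- The period function: `T(E)` is the minimal period of the periodic orbit of energy `E` in the
period annulus. (The infimum is over a one-element set when there is exactly one such orbit.) -/
noncomputable def periodFunction (F G : ℝ → ℝ) (E : ℝ) : ℝ :=
  sInf {τ : ℝ | ∃ O, IsPeriodicOrbit F G O τ ∧ O ⊆ periodAnnulus F G ∧
    ∀ p ∈ O, hamiltonian F G p = E}

/-- `T` is monotonically increasing on `(0, E₀)`: it is differentiable there with `T' ≥ 0`. -/
def MonotonicallyIncreasing (T : ℝ → ℝ) (E₀ : ℝ) : Prop :=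
  ∀ E ∈ Set.Ioo 0 E₀, DifferentiableAt ℝ T E ∧ 0 ≤ deriv T E

/-- `F(x) = 1 - cos x`; also `G(y) = 1 - cos y`. -/
noncomputable def cosPotential (x : ℝ) : ℝ := 1 - Real.cos x

/-- The four points `(0, ±π)` and `(±π, 0)`. -/
noncomputable def saddles : Set (ℝ × ℝ) :=
  {(0, Real.pi), (0, -Real.pi), (Real.pi, 0), (-Real.pi, 0)}

/-- `N(x, y) = 5 + cos 2x - 2 (cos x - 2) cos y`. -/
noncomputable def factorN (x y : ℝ) : ℝ :=
  5 + Real.cos (2 * x) - 2 * (Real.cos x - 2) * Real.cos y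

end SeparableHamiltonian

namespace SeparableHamiltonian

open Real Set Filter Topology

/-! The system is solved explicitly. With `u = (x + y) / 2` and `v = (x - y) / 2`, energy `E` means
`cos u * cos v = c` for `c = 1 - E / 2`. On the square `|u|, |v| < π / 2`, put `m = 1 - c ^ 2` and
`k = √m`; then `sin u = k sin φ` turns the flow into `φ' = √(1 - m sin² φ)`. Hence each level with
`0 < E < 2` is one closed orbit, with period the elliptic integral over `[0, 2π]`
(`isPeriodicOrbit_level`).

On the edges the moving coordinate satisfies `w' = ± cos w`, solved by the Gudermannian, so edges
are connections between corner saddles (`tendsto_saddles`). No periodic orbit meets them, and a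
connected filled neighbourhood cannot leave the square: the square is the period annulus
(`periodAnnulus_cosPotential`).

The period increases because the integrand increases with `m`, and `m` with `E`. The sign of the
criterion function is proved separately and plays no role in the monotonicity. -/

/-! ### Potential, energy and vector field -/

theorem deriv_cosPotential : deriv cosPotential = sin := by
  funext x
  have h : HasDerivAt cosPotential (sin x) x :=
    ((hasDerivAt_cos x).const_sub 1).congr_deriv (neg_neg _)
  exact h.deriv

theorem iteratedDeriv_two_cosPotential : iteratedDeriv 2 cosPotential = cos := by
  rw [iteratedDeriv_succ, iteratedDeriv_one, deriv_cosPotential, Real.deriv_sin]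

theorem iteratedDeriv_three_cosPotential : iteratedDeriv 3 cosPotential = fun x => -sin x := by
  rw [iteratedDeriv_succ, iteratedDeriv_two_cosPotential, Real.deriv_cos']

theorem hamiltonian_cosPotential (x y : ℝ) :
    hamiltonian cosPotential cosPotential (x, y) = 2 - cos x - cos y := by
  simp only [hamiltonian, cosPotential]; ring

theorem hamiltonian_cosPotential_eq_mul (p : ℝ × ℝ) :
    hamiltonian cosPotential cosPotential p
      = 2 - 2 * (cos ((p.1 + p.2) / 2) * cos ((p.1 - p.2) / 2)) := by
  have h := Real.cos_add_cos p.1 p.2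
  simp only [hamiltonian, cosPotential]
  linarith

theorem isSolution_cosPotential_iff (γ : ℝ → ℝ × ℝ) :
    IsSolution cosPotential cosPotential γ ↔
      ∀ t : ℝ, HasDerivAt (fun s => (γ s).1) (sin (γ t).2) t ∧
        HasDerivAt (fun s => (γ s).2) (-sin (γ t).1) t := by
  simp only [IsSolution, deriv_cosPotential]

/-! ### Factorization and sign of the criterion -/

/-- The criterion function factorizes through `factorN`. -/
theorem criterion_cosPotential (x y : ℝ) :
    criterion cosPotential cosPotential x y =
      4 * (1 - cos y) * sin (x / 2) ^ 4 * sin (y / 2) ^ 2 * factorN x y := by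
  have hs : ∀ z : ℝ, sin (z / 2) ^ 2 = (1 - cos z) / 2 := fun z => by
    rw [sin_sq_eq_half_sub, mul_div_cancel₀ z two_ne_zero]; ring
  have h4 : sin (x / 2) ^ 4 = ((1 - cos x) / 2) ^ 2 := by rw [← hs]; ring
  have hx := sin_sq x
  have hy := sin_sq y
  simp only [criterion, factorN, deriv_cosPotential, iteratedDeriv_two_cosPotential,
    iteratedDeriv_three_cosPotential, cosPotential, hs, h4, cos_two_mul]
  -- The `F' F'''` term is not a syntactic square; once it is, every sine can be eliminated.
  have e : 2 * (1 - cos x) * sin x * -sin x = -(2 * (1 - cos x) * sin x ^ 2) := by ring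
  rw [e, hx, hy]
  ring

/-- With `a = cos x`, `b = cos y`, one has `N = 2(2 - a)(a + b) + (2a - 1)² + 3`, and `H ≤ 2` says
`a + b ≥ 0`. -/
theorem factorN_nonneg {x y : ℝ} (h : (x, y) ∈ region cosPotential cosPotential 2) :
    0 ≤ factorN x y := by
  have h2 : cos x + cos y ≥ 0 := by
    have := h.2
    rw [hamiltonian_cosPotential] at this
    linarith
  rw [factorN, cos_two_mul]
  nlinarith [cos_le_one x, mul_nonneg h2 (by linarith [cos_le_one x] : 0 ≤ 2 - cos x),
    sq_nonneg (2 * cos x - 1)]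

theorem criterion_cosPotential_nonneg {x y : ℝ}
    (h : (x, y) ∈ region cosPotential cosPotential 2) :
    0 ≤ criterion cosPotential cosPotential x y := by
  rw [criterion_cosPotential]
  have h1 : 0 ≤ 1 - cos y := by linarith [cos_le_one y]
  have := factorN_nonneg h
  positivity

/-! ### Uniqueness, rotated coordinates and periods -/

/-- Solutions with a common value at some time coincide. -/
theorem IsSolution.eq_of_eq {γ δ : ℝ → ℝ × ℝ} (hγ : IsSolution cosPotential cosPotential γ)
    (hδ : IsSolution cosPotential cosPotential δ) {t₀ : ℝ} (h : γ t₀ = δ t₀) : γ = δ := by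
  rw [isSolution_cosPotential_iff] at hγ hδ
  have hL : LipschitzWith 1 (fun p : ℝ × ℝ => (sin p.2, -sin p.1)) := by
    have hs : LipschitzWith 1 sin := by
      refine LipschitzWith.of_dist_le_mul fun x y => ?_
      simpa [Real.dist_eq] using Real.abs_sin_sub_sin_le x y
    have h1 := hs.comp (LipschitzWith.prod_snd (α := ℝ) (β := ℝ))
    have h2 := (hs.comp (LipschitzWith.prod_fst (α := ℝ) (β := ℝ))).neg
    simpa using h1.prodMk h2
  refine ODE_solution_unique_univ (v := fun _ p => (sin p.2, -sin p.1)) (s := fun _ => univ)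
    (K := 1) (fun _ => hL.lipschitzOnWith) (fun t => ⟨?_, mem_univ _⟩)
    (fun t => ⟨?_, mem_univ _⟩) h
  · exact (hγ t).1.prodMk (hγ t).2
  · exact (hδ t).1.prodMk (hδ t).2

theorem IsSolution.comp_add_const {F G : ℝ → ℝ} {γ : ℝ → ℝ × ℝ} (hγ : IsSolution F G γ) (s : ℝ) :
    IsSolution F G (fun t => γ (t + s)) := fun t =>
  ⟨(hγ (t + s)).1.comp_add_const t s, (hγ (t + s)).2.comp_add_const t s⟩

/-- In the coordinates `u = (x + y) / 2`, `v = (x - y) / 2` the system is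
`u' = -cos u sin v`, `v' = sin u cos v`. -/
theorem isSolution_of_rotated {u v : ℝ → ℝ}
    (hu : ∀ t, HasDerivAt u (-(cos (u t) * sin (v t))) t)
    (hv : ∀ t, HasDerivAt v (sin (u t) * cos (v t)) t) :
    IsSolution cosPotential cosPotential (fun t => (u t + v t, u t - v t)) := by
  rw [isSolution_cosPotential_iff]
  refine fun t => ⟨?_, ?_⟩
  · refine ((hu t).add (hv t)).congr_deriv ?_
    simp only [sin_sub]; ring
  · refine ((hu t).sub (hv t)).congr_deriv ?_
    simp only [sin_add]; ring

/-- A constant solution is not a periodic orbit. -/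
theorem not_isLeast_period_of_const {γ : ℝ → ℝ × ℝ} {p : ℝ × ℝ} (h : ∀ t, γ t = p) (τ : ℝ) :
    ¬ IsLeast {s : ℝ | 0 < s ∧ Function.Periodic γ s} τ := by
  intro hτ
  have hpos := hτ.1.1
  have : τ ≤ τ / 2 := hτ.2 ⟨by linarith, fun t => by rw [h, h]⟩
  linarith

/-- Orbits that meet are time translates of each other, and translation preserves the set of
periods. -/
theorem IsPeriodicOrbit.period_unique {O : Set (ℝ × ℝ)} {τ τ' : ℝ} {O' : Set (ℝ × ℝ)}
    (h : IsPeriodicOrbit cosPotential cosPotential O τ)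
    (h' : IsPeriodicOrbit cosPotential cosPotential O' τ') (hO : (O ∩ O').Nonempty) : τ = τ' := by
  obtain ⟨γ, hγ, rfl, hl⟩ := h
  obtain ⟨δ, hδ, rfl, hl'⟩ := h'
  obtain ⟨_, ⟨a, rfl⟩, ⟨b, hb⟩⟩ := hO
  have e : γ = fun t => δ (t + (b - a)) :=
    hγ.eq_of_eq (hδ.comp_add_const _) (t₀ := a) (by rw [← hb]; congr 1; ring)
  have hs : {s : ℝ | 0 < s ∧ Function.Periodic γ s} = {s : ℝ | 0 < s ∧ Function.Periodic δ s} := by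
    ext s
    refine and_congr_right fun _ => ⟨fun h t => ?_, fun h t => ?_⟩
    · have := h (t - (b - a))
      simp only [e] at this
      convert this using 2 <;> ring
    · simp only [e]
      rw [← h (t + (b - a))]
      congr 1; ring
  rw [hs] at hl
  exact hl.unique hl'

/-! ### Elliptic integrals and the amplitude -/

/-- The incomplete elliptic integral of the first kind with parameter `m`. -/
noncomputable def ellipticIntegral (m θ : ℝ) : ℝ := ∫ s in (0 : ℝ)..θ, (√(1 - m * sin s ^ 2))⁻¹

/-- Negative `m` is admitted because differentiation in the parameter is carried out on a whole
half-line `Iio b`. -/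
theorem one_sub_mul_sin_sq_pos {m : ℝ} (hm1 : m < 1) (s : ℝ) :
    0 < 1 - m * sin s ^ 2 := by
  have h0 := sq_nonneg (sin s)
  have h1 := sin_sq_le_one s
  rcases le_or_gt m 0 with h | h
  · linarith [mul_nonpos_of_nonpos_of_nonneg h h0]
  · linarith [mul_le_of_le_one_right h.le h1]

theorem continuous_ellipticIntegrand {m : ℝ} (hm1 : m < 1) :
    Continuous fun s : ℝ => (√(1 - m * sin s ^ 2))⁻¹ :=
  Continuous.inv₀ (by fun_prop) fun s => (sqrt_pos.2 (one_sub_mul_sin_sq_pos hm1 s)).ne'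

theorem hasDerivAt_ellipticIntegral {m : ℝ} (hm1 : m < 1) (θ : ℝ) :
    HasDerivAt (ellipticIntegral m) (√(1 - m * sin θ ^ 2))⁻¹ θ :=
  (continuous_ellipticIntegrand hm1).integral_hasStrictDerivAt 0 θ |>.hasDerivAt

theorem strictMono_ellipticIntegral {m : ℝ} (hm1 : m < 1) : StrictMono (ellipticIntegral m) :=
  strictMono_of_hasDerivAt_pos (hasDerivAt_ellipticIntegral hm1) fun θ =>
    inv_pos.2 (sqrt_pos.2 (one_sub_mul_sin_sq_pos hm1 θ))

theorem ellipticIntegral_zero (m : ℝ) : ellipticIntegral m 0 = 0 := by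
  simp [ellipticIntegral]

theorem continuous_ellipticIntegral {m : ℝ} (hm1 : m < 1) : Continuous (ellipticIntegral m) :=
  continuous_iff_continuousAt.2 fun θ => (hasDerivAt_ellipticIntegral hm1 θ).continuousAt

/-- For `m ≥ 0` the integrand is at least `1`, so the integral grows at least as fast as `θ` in both
directions. -/
theorem surjective_ellipticIntegral {m : ℝ} (hm0 : 0 ≤ m) (hm1 : m < 1) :
    Function.Surjective (ellipticIntegral m) := by
  have hmono : Monotone fun θ => ellipticIntegral m θ - θ := by
    refine monotone_of_hasDerivAt_nonneg
      (fun θ => (hasDerivAt_ellipticIntegral hm1 θ).sub (hasDerivAt_id θ)) fun θ => ?_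
    have h1 : √(1 - m * sin θ ^ 2) ≤ 1 := by
      rw [sqrt_le_one]; linarith [mul_nonneg hm0 (sq_nonneg (sin θ))]
    have := (one_le_inv₀ (sqrt_pos.2 (one_sub_mul_sin_sq_pos hm1 θ))).2 h1
    simpa using this
  refine (continuous_ellipticIntegral hm1).surjective
    (tendsto_atTop_mono' _ ?_ tendsto_id) (tendsto_atBot_mono' _ ?_ tendsto_id)
  · filter_upwards [eventually_ge_atTop 0] with θ hθ
    have := hmono hθ
    simp only [ellipticIntegral_zero] at this
    simp only [id]; linarith
  · filter_upwards [eventually_le_atBot 0] with θ hθ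
    have := hmono hθ
    simp only [ellipticIntegral_zero] at this
    simp only [id]; linarith

theorem ellipticIntegral_add_two_pi {m : ℝ} (hm1 : m < 1) (θ : ℝ) :
    ellipticIntegral m (θ + 2 * π) = ellipticIntegral m θ + ellipticIntegral m (2 * π) := by
  have hp : Function.Periodic (fun s : ℝ => (√(1 - m * sin s ^ 2))⁻¹) (2 * π) := fun s => by
    simp only [sin_add_two_pi]
  have h := hp.intervalIntegral_add_eq θ 0
  have hi := fun a b => (continuous_ellipticIntegrand hm1).intervalIntegrable
    (μ := MeasureTheory.volume) a b
  rw [zero_add] at h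
  simp only [ellipticIntegral]
  rw [← h, intervalIntegral.integral_add_adjacent_intervals (hi _ _) (hi _ _)]

/-- The Jacobi amplitude, the inverse function of the elliptic integral. -/
theorem exists_amplitude {m : ℝ} (hm0 : 0 ≤ m) (hm1 : m < 1) :
    ∃ φ : ℝ → ℝ, (∀ t, ellipticIntegral m (φ t) = t) ∧ (∀ θ, φ (ellipticIntegral m θ) = θ) ∧
      ∀ t, HasDerivAt φ (√(1 - m * sin (φ t) ^ 2)) t := by
  let e := (strictMono_ellipticIntegral hm1).orderIsoOfSurjective _
    (surjective_ellipticIntegral hm0 hm1)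
  have he : ∀ θ, e θ = ellipticIntegral m θ := fun θ => rfl
  have h1 : ∀ t, ellipticIntegral m (e.symm t) = t := fun t => by rw [← he, e.apply_symm_apply]
  refine ⟨e.symm, h1, fun θ => by rw [← he, e.symm_apply_apply], fun t => ?_⟩
  have hpos := sqrt_pos.2 (one_sub_mul_sin_sq_pos hm1 (e.symm t))
  simpa using HasDerivAt.of_local_left_inverse e.symm.continuous.continuousAt
    (hasDerivAt_ellipticIntegral hm1 (e.symm t)) (inv_pos.2 hpos).ne' (Eventually.of_forall h1)

/-- The complete elliptic integral is differentiable and nondecreasing in the parameter. -/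
theorem hasDerivAt_ellipticIntegral_param {m : ℝ} (hm1 : m < 1) :
    ∃ d, 0 ≤ d ∧ HasDerivAt (fun μ => ellipticIntegral μ (2 * π)) d m := by
  -- The parameter derivative of the integrand increases with `μ`, so its value at `b` dominates it
  -- for all `μ < b`.
  obtain ⟨b, hmb, hb1⟩ := exists_between hm1
  have hD : ∀ μ < 1, ∀ s : ℝ, HasDerivAt (fun μ => (√(1 - μ * sin s ^ 2))⁻¹)
      (sin s ^ 2 / (2 * √(1 - μ * sin s ^ 2) * √(1 - μ * sin s ^ 2) ^ 2)) μ := by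
    intro μ hμ s
    have hp := one_sub_mul_sin_sq_pos hμ s
    have h1 : HasDerivAt (fun μ => 1 - μ * sin s ^ 2) (-(sin s ^ 2)) μ := by
      simpa using ((hasDerivAt_id μ).mul_const (sin s ^ 2)).const_sub 1
    refine ((h1.sqrt hp.ne').inv (sqrt_pos.2 hp).ne').congr_deriv ?_
    rw [neg_div, neg_div, neg_div, neg_neg, div_div]
  have hc : ∀ μ < 1, Continuous fun s : ℝ =>
      sin s ^ 2 / (2 * √(1 - μ * sin s ^ 2) * √(1 - μ * sin s ^ 2) ^ 2) := by
    intro μ hμ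
    refine Continuous.div (by fun_prop) (by fun_prop) fun s => ?_
    have := sqrt_pos.2 (one_sub_mul_sin_sq_pos hμ s)
    positivity
  have key := intervalIntegral.hasDerivAt_integral_of_dominated_loc_of_deriv_le
    (μ := MeasureTheory.volume) (a := 0) (b := 2 * π) (x₀ := m) (s := Iio b)
    (F := fun μ s => (√(1 - μ * sin s ^ 2))⁻¹)
    (F' := fun μ s => sin s ^ 2 / (2 * √(1 - μ * sin s ^ 2) * √(1 - μ * sin s ^ 2) ^ 2))
    (bound := fun s => sin s ^ 2 / (2 * √(1 - b * sin s ^ 2) * √(1 - b * sin s ^ 2) ^ 2))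
    (Iio_mem_nhds hmb)
    ((eventually_lt_nhds hm1).mono fun μ hμ =>
      (continuous_ellipticIntegrand hμ).aestronglyMeasurable)
    ((continuous_ellipticIntegrand hm1).intervalIntegrable _ _)
    (hc m hm1).aestronglyMeasurable
    (Eventually.of_forall fun s _ μ hμ => ?_)
    ((hc b hb1).intervalIntegrable _ _)
    (Eventually.of_forall fun s _ μ hμ => hD μ (lt_trans hμ hb1) s)
  · refine ⟨_, intervalIntegral.integral_nonneg (by positivity) fun s _ => ?_, key.2⟩
    positivity
  · rw [norm_of_nonneg (by positivity)]
    have := sqrt_pos.2 (one_sub_mul_sin_sq_pos hb1 s)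
    have hle : √(1 - b * sin s ^ 2) ≤ √(1 - μ * sin s ^ 2) := by
      apply sqrt_le_sqrt
      have : μ * sin s ^ 2 ≤ b * sin s ^ 2 :=
        mul_le_mul_of_nonneg_right (le_of_lt hμ) (sq_nonneg _)
      linarith
    gcongr

/-! ### Periodic orbits in the square -/

/-- The open square in which `|x| + |y| < π`. -/
def openDiamond : Set (ℝ × ℝ) :=
  {p | (p.1 + p.2) / 2 ∈ Ioo (-(π / 2)) (π / 2) ∧ (p.1 - p.2) / 2 ∈ Ioo (-(π / 2)) (π / 2)}

theorem exists_sin_cos_eq {a b : ℝ} (h : a ^ 2 + b ^ 2 = 1) : ∃ θ, sin θ = a ∧ cos θ = b := by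
  have hn : ‖(⟨b, a⟩ : ℂ)‖ = 1 := by
    rw [Complex.norm_def, Complex.normSq_mk, sqrt_eq_one]; linarith
  have h0 : (⟨b, a⟩ : ℂ) ≠ 0 := by
    rw [← norm_ne_zero_iff, hn]; exact one_ne_zero
  exact ⟨Complex.arg ⟨b, a⟩, by rw [Complex.sin_arg, hn, div_one],
    by rw [Complex.cos_arg h0, hn, div_one]⟩

/-- Inside the square, each energy level in `(0, 2)` is a periodic orbit. -/
theorem isPeriodicOrbit_level {E : ℝ} (hE : E ∈ Ioo (0 : ℝ) 2) :
    IsPeriodicOrbit cosPotential cosPotential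
      (openDiamond ∩ {p | hamiltonian cosPotential cosPotential p = E})
      (ellipticIntegral (1 - (1 - E / 2) ^ 2) (2 * π)) := by
  obtain ⟨hE0, hE2⟩ := hE
  set c := 1 - E / 2 with hc
  set m := 1 - c ^ 2 with hm
  have hc0 : 0 < c := by rw [hc]; linarith
  have hc1 : c < 1 := by rw [hc]; linarith
  have hm0 : 0 < m := by rw [hm]; nlinarith
  have hm1 : m < 1 := by rw [hm]; nlinarith
  set k := √m with hk
  have hk0 : 0 < k := sqrt_pos.2 hm0
  have hk2 : k ^ 2 = m := sq_sqrt hm0.le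
  obtain ⟨φ, hΦφ, hφΦ, hφ⟩ := exists_amplitude hm0.le hm1
  have hmono := strictMono_ellipticIntegral hm1
  have hφ0 : φ 0 = 0 := by simpa [ellipticIntegral_zero] using hφΦ 0
  have hφper : ∀ t, φ (t + ellipticIntegral m (2 * π)) = φ t + 2 * π := fun t => by
    rw [← hφΦ (φ t + 2 * π), ellipticIntegral_add_two_pi hm1, hΦφ]
  set Δ : ℝ → ℝ := fun θ => √(1 - m * sin θ ^ 2) with hΔ
  have hΔ0 : ∀ θ, 0 < Δ θ := fun θ => sqrt_pos.2 (one_sub_mul_sin_sq_pos hm1 θ)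
  have hΔ2 : ∀ θ, Δ θ ^ 2 = 1 - m * sin θ ^ 2 := fun θ =>
    sq_sqrt (one_sub_mul_sin_sq_pos hm1 θ).le
  -- From `sin u = k sin φ` follow `cos u = Δ` and `cos v = c / Δ`; then `u' = -cos u sin v` forces
  -- `sin v = -k cos φ / Δ`, that is, `tan v = -(k / c) cos φ`.
  set U : ℝ → ℝ := fun θ => arcsin (k * sin θ) with hU
  set V : ℝ → ℝ := fun θ => -arctan (k / c * cos θ) with hV
  have hks : ∀ θ, (k * sin θ) ^ 2 < 1 := fun θ => by
    have := one_sub_mul_sin_sq_pos hm1 θ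
    rw [mul_pow, hk2]; linarith
  have hksl : ∀ θ, -1 < k * sin θ := fun θ => (abs_lt.1 ((sq_lt_one_iff_abs_lt_one _).1 (hks θ))).1
  have hksr : ∀ θ, k * sin θ < 1 := fun θ => (abs_lt.1 ((sq_lt_one_iff_abs_lt_one _).1 (hks θ))).2
  have hr : ∀ θ, √(1 + (k / c * cos θ) ^ 2) = Δ θ / c := fun θ => by
    rw [sqrt_eq_iff_eq_sq (by positivity) (div_pos (hΔ0 θ) hc0).le, div_pow, hΔ2, mul_pow, div_pow, hk2, cos_sq']
    field_simp
    rw [hm]; ring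
  have hsU : ∀ θ, sin (U θ) = k * sin θ := fun θ => sin_arcsin (hksl θ).le (hksr θ).le
  have hcU : ∀ θ, cos (U θ) = Δ θ := fun θ => by
    simp only [hU, hΔ]; rw [cos_arcsin, mul_pow, hk2]
  have hsV : ∀ θ, sin (V θ) = -(k * cos θ / Δ θ) := fun θ => by
    have := (hΔ0 θ).ne'
    simp only [hV]; rw [sin_neg, sin_arctan, hr]; field_simp
  have hcV : ∀ θ, cos (V θ) = c / Δ θ := fun θ => by
    have := (hΔ0 θ).ne'
    simp only [hV]; rw [cos_neg, cos_arctan, hr]; field_simp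
  have hγ : IsSolution cosPotential cosPotential
      (fun t => (U (φ t) + V (φ t), U (φ t) - V (φ t))) := by
    refine isSolution_of_rotated (u := fun t => U (φ t)) (v := fun t => V (φ t))
      (fun t => ?_) fun t => ?_
    · have h1 := ((hasDerivAt_arcsin (hksl (φ t)).ne' (hksr (φ t)).ne).comp t
        (((hφ t).sin).const_mul k))
      refine h1.congr_deriv ?_
      have e : √(1 - (k * sin (φ t)) ^ 2) = Δ (φ t) := by rw [mul_pow, hk2]
      have := (hΔ0 (φ t)).ne'
      rw [e, hcU, hsV]
      change 1 / Δ (φ t) * (k * (cos (φ t) * Δ (φ t))) = _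
      field_simp
    · have h1 := (((hφ t).cos).const_mul (k / c)).arctan.neg
      refine h1.congr_deriv ?_
      have hne := (hΔ0 (φ t)).ne'
      have e : 1 + (k / c * cos (φ t)) ^ 2 = (Δ (φ t) / c) ^ 2 := by
        rw [← hr, sq_sqrt (by positivity)]
      rw [e, hsU, hcV]
      change -(1 / (Δ (φ t) / c) ^ 2 * (k / c * (-sin (φ t) * Δ (φ t)))) = _
      field_simp
  refine ⟨_, hγ, ?_, ?_⟩
  · ext p
    constructor
    · rintro ⟨t, rfl⟩
      have e1 : (U (φ t) + V (φ t) + (U (φ t) - V (φ t))) / 2 = U (φ t) := by ring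
      have e2 : (U (φ t) + V (φ t) - (U (φ t) - V (φ t))) / 2 = V (φ t) := by ring
      refine ⟨?_, ?_⟩
      · simp only [openDiamond, mem_ofPred_eq, e1, e2]
        refine ⟨⟨neg_pi_div_two_lt_arcsin.2 (hksl _), arcsin_lt_pi_div_two.2 (hksr _)⟩, ?_, ?_⟩
        · simp only [hV]; linarith [arctan_lt_pi_div_two (k / c * cos (φ t))]
        · simp only [hV]; linarith [neg_pi_div_two_lt_arctan (k / c * cos (φ t))]
      · have hne := (hΔ0 (φ t)).ne'
        rw [mem_ofPred_eq, hamiltonian_cosPotential_eq_mul]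
        simp only [e1, e2, hcU, hcV]
        rw [mul_div_cancel₀ _ hne, hc]; ring
    · rintro ⟨⟨hu, hv⟩, hp⟩
      rw [mem_ofPred_eq, hamiltonian_cosPotential_eq_mul] at hp
      set u := (p.1 + p.2) / 2 with hudef
      set v := (p.1 - p.2) / 2 with hvdef
      have hcu := cos_pos_of_mem_Ioo hu
      have hcv := cos_pos_of_mem_Ioo hv
      have hcc : cos u * cos v = c := by rw [hc]; linarith
      -- Inverting the parametrization gives these as sine and cosine of the angle; the relation is
      -- `k² = 1 - cos² u cos² v = sin² u + cos² u sin² v`.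
      have hsq : (sin u / k) ^ 2 + (-(cos u * sin v / k)) ^ 2 = 1 := by
        have : k ^ 2 = 1 - (cos u * cos v) ^ 2 := by rw [hcc, hk2]
        have h1 := sin_sq u
        have h2 := sin_sq v
        field_simp
        rw [this]; nlinarith
      obtain ⟨θ, hθ1, hθ2⟩ := exists_sin_cos_eq hsq
      have hUθ : U θ = u := by
        simp only [hU]
        rw [hθ1, mul_div_cancel₀ _ hk0.ne', arcsin_sin hu.1.le hu.2.le]
      have hVθ : V θ = v := by
        simp only [hV]
        have : k / c * cos θ = tan (-v) := by
          rw [hθ2, tan_neg, tan_eq_sin_div_cos, ← hcc]; field_simp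
        rw [this, arctan_tan (by linarith [hv.2]) (by linarith [hv.1]), neg_neg]
      refine ⟨ellipticIntegral m θ, ?_⟩
      simp only [hφΦ, hUθ, hVθ]
      ext <;> simp only [hudef, hvdef] <;> ring
  · have hKpos : 0 < ellipticIntegral m (2 * π) := by
      rw [← ellipticIntegral_zero m]; exact hmono (by positivity)
    refine ⟨⟨hKpos, fun t => ?_⟩, fun s ⟨hs0, hs⟩ => ?_⟩
    · simp only [hφper, hU, hV, sin_add_two_pi, cos_add_two_pi]
    · have h0 := hs 0
      simp only [zero_add, hφ0, Prod.mk.injEq] at h0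
      have hU' : U (φ s) = U 0 := by linarith [h0.1, h0.2]
      have hV' : V (φ s) = V 0 := by linarith [h0.1, h0.2]
      -- Minimality: `v` is injective in `cos φ`, so any period `s > 0` has `φ s` a positive
      -- multiple of `2π`.
      have hcos : cos (φ s) = 1 := by
        simp only [hV, neg_inj, arctan_inj, cos_zero] at hV'
        exact mul_left_cancel₀ (div_pos hk0 hc0).ne' hV'
      obtain ⟨n, hn⟩ := (cos_eq_one_iff _).1 hcos
      have hφs : 0 < φ s := by
        rw [← hmono.lt_iff_lt, hΦφ, ellipticIntegral_zero]; exact hs0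
      have hn1 : 1 ≤ n := by
        by_contra! hlt
        have : (n : ℝ) ≤ 0 := by exact_mod_cast Int.lt_add_one_iff.1 hlt
        nlinarith [pi_pos]
      have hn1' : (1 : ℝ) ≤ n := by exact_mod_cast hn1
      rw [← hΦφ s]
      refine hmono.monotone ?_
      rw [← hn]; nlinarith [pi_pos]

/-! ### Topology and energy of the square -/

theorem isOpen_openDiamond : IsOpen openDiamond :=
  (isOpen_Ioo.preimage (f := fun p : ℝ × ℝ => (p.1 + p.2) / 2) (by fun_prop)).inter
    (isOpen_Ioo.preimage (f := fun p : ℝ × ℝ => (p.1 - p.2) / 2) (by fun_prop))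

theorem closure_openDiamond_subset : closure openDiamond ⊆
    {p | (p.1 + p.2) / 2 ∈ Icc (-(π / 2)) (π / 2) ∧ (p.1 - p.2) / 2 ∈ Icc (-(π / 2)) (π / 2)} :=
  closure_minimal (fun _ hp => ⟨Ioo_subset_Icc_self hp.1, Ioo_subset_Icc_self hp.2⟩)
    ((isClosed_Icc.preimage (f := fun p : ℝ × ℝ => (p.1 + p.2) / 2) (by fun_prop)).inter
      (isClosed_Icc.preimage (f := fun p : ℝ × ℝ => (p.1 - p.2) / 2) (by fun_prop)))

theorem smul_mem_openDiamond {p : ℝ × ℝ}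
    (hp : (p.1 + p.2) / 2 ∈ Icc (-(π / 2)) (π / 2) ∧ (p.1 - p.2) / 2 ∈ Icc (-(π / 2)) (π / 2))
    {s : ℝ} (hs : s ∈ Ico (0 : ℝ) 1) : s • p ∈ openDiamond := by
  have key : ∀ w ∈ Icc (-(π / 2)) (π / 2), s * w ∈ Ioo (-(π / 2)) (π / 2) := fun w hw => by
    have hpi := pi_pos
    obtain ⟨h0, h1⟩ := hs
    obtain ⟨hl, hr⟩ := hw
    constructor <;> nlinarith
  have e1 : ((s • p).1 + (s • p).2) / 2 = s * ((p.1 + p.2) / 2) := by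
    simp only [Prod.smul_fst, Prod.smul_snd, smul_eq_mul]; ring
  have e2 : ((s • p).1 - (s • p).2) / 2 = s * ((p.1 - p.2) / 2) := by
    simp only [Prod.smul_fst, Prod.smul_snd, smul_eq_mul]; ring
  refine ⟨?_, ?_⟩
  · rw [e1]; exact key _ hp.1
  · rw [e2]; exact key _ hp.2

/-- Scaling by `s < 1` moves the closed square into the open one; let `s → 1`. -/
theorem mem_closure_openDiamond {p : ℝ × ℝ}
    (hp : (p.1 + p.2) / 2 ∈ Icc (-(π / 2)) (π / 2) ∧ (p.1 - p.2) / 2 ∈ Icc (-(π / 2)) (π / 2)) :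
    p ∈ closure openDiamond := by
  have h1 : (1 : ℝ) ∈ closure (Ico (0 : ℝ) 1) := by
    rw [closure_Ico zero_ne_one]; exact right_mem_Icc.2 zero_le_one
  have hc : Continuous fun s : ℝ => s • p := by fun_prop
  have := image_closure_subset_closure_image hc (mem_image_of_mem _ h1)
  rw [one_smul] at this
  refine closure_mono ?_ this
  rintro _ ⟨s, hs, rfl⟩
  exact smul_mem_openDiamond hp hs

theorem zero_mem_openDiamond : ((0, 0) : ℝ × ℝ) ∈ openDiamond := by
  have := pi_pos
  simp [openDiamond, this]

theorem isConnected_openDiamond : IsConnected openDiamond := by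
  refine ⟨⟨_, zero_mem_openDiamond⟩, Convex.isPreconnected ?_⟩
  refine ((convex_Ioo (-(π / 2)) (π / 2)).is_linear_preimage
      (f := fun p : ℝ × ℝ => (p.1 + p.2) / 2) ⟨fun x y => ?_, fun c x => ?_⟩).inter
    ((convex_Ioo (-(π / 2)) (π / 2)).is_linear_preimage
      (f := fun p : ℝ × ℝ => (p.1 - p.2) / 2) ⟨fun x y => ?_, fun c x => ?_⟩)
  all_goals
    simp only [Prod.fst_add, Prod.snd_add, Prod.smul_fst, Prod.smul_snd, smul_eq_mul]
    ring

theorem hamiltonian_mem_Ico {p : ℝ × ℝ} (hp : p ∈ openDiamond) :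
    hamiltonian cosPotential cosPotential p ∈ Ico (0 : ℝ) 2 := by
  have h := mul_pos (cos_pos_of_mem_Ioo hp.1) (cos_pos_of_mem_Ioo hp.2)
  rw [hamiltonian_cosPotential_eq_mul]
  refine ⟨?_, by linarith⟩
  have := mul_le_one₀ (cos_le_one ((p.1 + p.2) / 2)) (cos_pos_of_mem_Ioo hp.2).le
    (cos_le_one ((p.1 - p.2) / 2))
  linarith

theorem hamiltonian_pos {p : ℝ × ℝ} (hp : p ∈ openDiamond) (h0 : p ≠ (0, 0)) :
    0 < hamiltonian cosPotential cosPotential p := by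
  refine lt_of_le_of_ne (hamiltonian_mem_Ico hp).1 fun h => h0 ?_
  have hpi := pi_pos
  obtain ⟨⟨a1, a2⟩, a3, a4⟩ := hp
  have hx := cos_le_one p.1
  have hy := cos_le_one p.2
  simp only [hamiltonian, cosPotential] at h
  have hx0 := (cos_eq_one_iff_of_lt_of_lt (by linarith) (by linarith)).1
    (by linarith : cos p.1 = 1)
  have hy0 := (cos_eq_one_iff_of_lt_of_lt (by linarith) (by linarith)).1
    (by linarith : cos p.2 = 1)
  exact Prod.ext hx0 hy0

theorem isFilledNeighborhood_openDiamond :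
    IsFilledNeighborhood cosPotential cosPotential openDiamond :=
  ⟨isOpen_openDiamond, isConnected_openDiamond, zero_mem_openDiamond, fun _ hp h0 =>
    ⟨_, _, isPeriodicOrbit_level ⟨hamiltonian_pos hp h0, (hamiltonian_mem_Ico hp).2⟩,
      ⟨hp, rfl⟩, inter_subset_left⟩⟩

theorem mem_frontier_openDiamond {p : ℝ × ℝ} : p ∈ frontier openDiamond ↔
    ∃ u v : ℝ, p = (u + v, u - v) ∧ u ∈ Icc (-(π / 2)) (π / 2) ∧ v ∈ Icc (-(π / 2)) (π / 2) ∧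
      (u = π / 2 ∨ u = -(π / 2) ∨ v = π / 2 ∨ v = -(π / 2)) := by
  rw [isOpen_openDiamond.frontier_eq]
  constructor
  · rintro ⟨hc, hn⟩
    obtain ⟨hu, hv⟩ := closure_openDiamond_subset hc
    refine ⟨(p.1 + p.2) / 2, (p.1 - p.2) / 2, Prod.ext (by ring) (by ring), hu, hv, ?_⟩
    by_contra! h
    obtain ⟨h1, h2, h3, h4⟩ := h
    exact hn ⟨⟨lt_of_le_of_ne hu.1 h2.symm, lt_of_le_of_ne hu.2 h1⟩,
      lt_of_le_of_ne hv.1 h4.symm, lt_of_le_of_ne hv.2 h3⟩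
  · rintro ⟨u, v, rfl, hu, hv, h⟩
    have e1 : (u + v + (u - v)) / 2 = u := by ring
    have e2 : (u + v - (u - v)) / 2 = v := by ring
    refine ⟨mem_closure_openDiamond (by simpa only [e1, e2] using ⟨hu, hv⟩), fun hd => ?_⟩
    simp only [openDiamond, mem_ofPred_eq, e1, e2] at hd
    obtain ⟨⟨h1, h2⟩, h3, h4⟩ := hd
    rcases h with h | h | h | h <;> linarith

theorem mem_saddles_of_abs_eq {u v : ℝ} (hu : u = π / 2 ∨ u = -(π / 2))
    (hv : v = π / 2 ∨ v = -(π / 2)) : (u + v, u - v) ∈ saddles := by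
  rcases hu with rfl | rfl <;> rcases hv with rfl | rfl
  · exact .inr (.inr (.inl (Prod.ext (by ring) (by ring))))
  · exact .inl (Prod.ext (by ring) (by ring))
  · exact .inr (.inl (Prod.ext (by ring) (by ring)))
  · exact .inr (.inr (.inr (Prod.ext (by ring) (by ring))))

/-! ### Saddle connections on the boundary -/

theorem tendsto_sinh_atTop : Tendsto sinh atTop atTop := sinhOrderIso.tendsto_atTop

theorem tendsto_sinh_atBot : Tendsto sinh atBot atBot := sinhOrderIso.tendsto_atBot

/-- The Gudermannian function. -/
noncomputable def gudermannian (t : ℝ) : ℝ := arctan (sinh t)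

/-- Both sides equal `1 / cosh t`; this is the equation of motion along an edge. -/
theorem hasDerivAt_gudermannian (t : ℝ) :
    HasDerivAt gudermannian (cos (gudermannian t)) t := by
  refine (hasDerivAt_sinh t).arctan.congr_deriv ?_
  have h : 1 + sinh t ^ 2 = cosh t ^ 2 := by rw [cosh_sq]; ring
  have := (cosh_pos t).ne'
  rw [gudermannian, cos_arctan, h, sqrt_sq (cosh_pos t).le]
  field_simp

theorem tendsto_gudermannian_atTop : Tendsto gudermannian atTop (𝓝 (π / 2)) :=
  (tendsto_arctan_atTop.mono_right nhdsWithin_le_nhds).comp tendsto_sinh_atTop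

theorem tendsto_gudermannian_atBot : Tendsto gudermannian atBot (𝓝 (-(π / 2))) :=
  (tendsto_arctan_atBot.mono_right nhdsWithin_le_nhds).comp tendsto_sinh_atBot

theorem exists_gudermannian_eq {v : ℝ} (hv : v ∈ Ioo (-(π / 2)) (π / 2)) :
    ∃ t, gudermannian t = v :=
  ⟨arsinh (tan v), by rw [gudermannian, sinh_arsinh, arctan_tan hv.1 hv.2]⟩

/-- Solutions on the boundary of the square connect two distinct saddles. -/
theorem tendsto_saddles {γ : ℝ → ℝ × ℝ} (hγ : IsSolution cosPotential cosPotential γ)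
    (h0 : γ 0 ∈ frontier openDiamond) (hs : γ 0 ∉ saddles) :
    ∃ p ∈ saddles, ∃ q ∈ saddles, p ≠ q ∧ Tendsto γ atBot (𝓝 p) ∧ Tendsto γ atTop (𝓝 q) := by
  have hpi := pi_pos
  obtain ⟨u, v, he, ⟨hu1, hu2⟩, ⟨hv1, hv2⟩, h⟩ := mem_frontier_openDiamond.1 h0
  rw [he] at hs
  -- Away from the corners, which are the saddles, exactly one coordinate is extremal.
  have hcases : ((u = π / 2 ∨ u = -(π / 2)) ∧ v ∈ Ioo (-(π / 2)) (π / 2)) ∨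
      ((v = π / 2 ∨ v = -(π / 2)) ∧ u ∈ Ioo (-(π / 2)) (π / 2)) := by
    rcases h with h | h | h | h
    all_goals first
      | exact .inl ⟨by simp [h], lt_of_le_of_ne hv1 fun e =>
          hs (mem_saddles_of_abs_eq (by simp [h]) (.inr e.symm)),
          lt_of_le_of_ne hv2 fun e => hs (mem_saddles_of_abs_eq (by simp [h]) (.inl e))⟩
      | exact .inr ⟨by simp [h], lt_of_le_of_ne hu1 fun e =>
          hs (mem_saddles_of_abs_eq (.inr e.symm) (by simp [h])),
          lt_of_le_of_ne hu2 fun e => hs (mem_saddles_of_abs_eq (.inl e) (by simp [h]))⟩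
  have hfwd : ∀ c, Tendsto (fun t => gudermannian (t + c)) atTop (𝓝 (π / 2)) ∧
      Tendsto (fun t => gudermannian (t + c)) atBot (𝓝 (-(π / 2))) := fun c =>
    ⟨tendsto_gudermannian_atTop.comp (tendsto_atTop_add_const_right _ _ tendsto_id),
      tendsto_gudermannian_atBot.comp (tendsto_atBot_add_const_right _ _ tendsto_id)⟩
  have hbwd : ∀ c, Tendsto (fun t => gudermannian (-t + c)) atTop (𝓝 (-(π / 2))) ∧
      Tendsto (fun t => gudermannian (-t + c)) atBot (𝓝 (π / 2)) := fun c =>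
    ⟨tendsto_gudermannian_atBot.comp
        (tendsto_atBot_add_const_right _ _ tendsto_neg_atTop_atBot),
      tendsto_gudermannian_atTop.comp
        (tendsto_atTop_add_const_right _ _ tendsto_neg_atBot_atTop)⟩
  have hfd : ∀ c t, HasDerivAt (fun t => gudermannian (t + c)) (cos (gudermannian (t + c))) t :=
    fun c t => (hasDerivAt_gudermannian (t + c)).comp_add_const t c
  have hbd : ∀ c t,
      HasDerivAt (fun t => gudermannian (-t + c)) (-cos (gudermannian (-t + c))) t := fun c t =>
    (HasDerivAt.comp (h := fun t => -t + c) t (hasDerivAt_gudermannian (-t + c))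
      ((hasDerivAt_neg t).add_const c)).congr_deriv (mul_neg_one _)
  have hpm : ∀ w : ℝ, w = π / 2 ∨ w = -(π / 2) → cos w = 0 := fun w hw => by
    rcases hw with rfl | rfl <;> simp
  -- The extremal coordinate stays fixed, and its sign decides whether the other runs along the
  -- Gudermannian forwards or backwards in time.
  rcases hcases with ⟨hu, hv⟩ | ⟨hv, hu⟩
  · have hcu := hpm u hu
    obtain ⟨c, rfl⟩ := exists_gudermannian_eq hv
    rcases hu with rfl | rfl
    · have hsol := isSolution_of_rotated (u := fun _ => π / 2) (v := fun t => gudermannian (t + c))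
        (fun t => by simpa [hcu] using hasDerivAt_const t (π / 2))
        (fun t => by simpa using hfd c t)
      obtain rfl := hγ.eq_of_eq hsol (t₀ := 0) (by rw [he, zero_add])
      refine ⟨_, mem_saddles_of_abs_eq (.inl rfl) (.inr rfl), _,
        mem_saddles_of_abs_eq (.inl rfl) (.inl rfl), ?_,
        ((hfwd c).2.const_add _).prodMk_nhds ((hfwd c).2.const_sub _),
        ((hfwd c).1.const_add _).prodMk_nhds ((hfwd c).1.const_sub _)⟩
      intro e; have := congrArg Prod.fst e; simp only at this; linarith
    · have hsol := isSolution_of_rotated (u := fun _ => -(π / 2))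
        (v := fun t => gudermannian (-t + c))
        (fun t => by simpa [hcu] using hasDerivAt_const t (-(π / 2)))
        (fun t => by simpa using hbd c t)
      obtain rfl := hγ.eq_of_eq hsol (t₀ := 0) (by rw [he, neg_zero, zero_add])
      refine ⟨_, mem_saddles_of_abs_eq (.inr rfl) (.inl rfl), _,
        mem_saddles_of_abs_eq (.inr rfl) (.inr rfl), ?_,
        ((hbwd c).2.const_add _).prodMk_nhds ((hbwd c).2.const_sub _),
        ((hbwd c).1.const_add _).prodMk_nhds ((hbwd c).1.const_sub _)⟩
      intro e; have := congrArg Prod.fst e; simp only at this; linarith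
  · have hcv := hpm v hv
    obtain ⟨c, rfl⟩ := exists_gudermannian_eq hu
    rcases hv with rfl | rfl
    · have hsol := isSolution_of_rotated (u := fun t => gudermannian (-t + c))
        (v := fun _ => π / 2) (fun t => by simpa using hbd c t)
        (fun t => by simpa [hcv] using hasDerivAt_const t (π / 2))
      obtain rfl := hγ.eq_of_eq hsol (t₀ := 0) (by rw [he, neg_zero, zero_add])
      refine ⟨_, mem_saddles_of_abs_eq (.inl rfl) (.inl rfl), _,
        mem_saddles_of_abs_eq (.inr rfl) (.inl rfl), ?_,
        ((hbwd c).2.add_const _).prodMk_nhds ((hbwd c).2.sub_const _),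
        ((hbwd c).1.add_const _).prodMk_nhds ((hbwd c).1.sub_const _)⟩
      intro e; have := congrArg Prod.fst e; simp only at this; linarith
    · have hsol := isSolution_of_rotated (u := fun t => gudermannian (t + c))
        (v := fun _ => -(π / 2)) (fun t => by simpa using hfd c t)
        (fun t => by simpa [hcv] using hasDerivAt_const t (-(π / 2)))
      obtain rfl := hγ.eq_of_eq hsol (t₀ := 0) (by rw [he, zero_add])
      refine ⟨_, mem_saddles_of_abs_eq (.inr rfl) (.inr rfl), _,
        mem_saddles_of_abs_eq (.inl rfl) (.inr rfl), ?_,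
        ((hfwd c).2.add_const _).prodMk_nhds ((hfwd c).2.sub_const _),
        ((hfwd c).1.add_const _).prodMk_nhds ((hfwd c).1.sub_const _)⟩
      intro e; have := congrArg Prod.fst e; simp only at this; linarith

theorem sin_eq_zero_of_mem_saddles {p : ℝ × ℝ} (hp : p ∈ saddles) : sin p.1 = 0 ∧ sin p.2 = 0 := by
  rcases hp with rfl | rfl | rfl | rfl <;> simp

theorem saddles_subset_frontier : saddles ⊆ frontier openDiamond := by
  have hpi := pi_pos
  have hl : -(π / 2) ∈ Icc (-(π / 2)) (π / 2) := ⟨le_rfl, by linarith⟩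
  have hr : π / 2 ∈ Icc (-(π / 2)) (π / 2) := ⟨by linarith, le_rfl⟩
  rintro p (rfl | rfl | rfl | rfl) <;> rw [mem_frontier_openDiamond]
  · exact ⟨π / 2, -(π / 2), Prod.ext (by ring) (by ring), hr, hl, by simp⟩
  · exact ⟨-(π / 2), π / 2, Prod.ext (by ring) (by ring), hl, hr, by simp⟩
  · exact ⟨π / 2, π / 2, Prod.ext (by ring) (by ring), hr, hr, by simp⟩
  · exact ⟨-(π / 2), -(π / 2), Prod.ext (by ring) (by ring), hl, hl, by simp⟩

theorem hamiltonian_eq_two_of_mem_frontier {p : ℝ × ℝ} (hp : p ∈ frontier openDiamond) :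
    hamiltonian cosPotential cosPotential p = 2 := by
  obtain ⟨u, v, rfl, -, -, h⟩ := mem_frontier_openDiamond.1 hp
  have e1 : (u + v + (u - v)) / 2 = u := by ring
  have e2 : (u + v - (u - v)) / 2 = v := by ring
  rw [hamiltonian_cosPotential_eq_mul]
  simp only [e1, e2]
  rcases h with rfl | rfl | rfl | rfl <;> simp

/-- No periodic orbit meets the boundary of the square. -/
theorem IsPeriodicOrbit.notMem_frontier {O : Set (ℝ × ℝ)} {τ : ℝ}
    (hO : IsPeriodicOrbit cosPotential cosPotential O τ) {p : ℝ × ℝ} (hp : p ∈ O) :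
    p ∉ frontier openDiamond := by
  intro hf
  obtain ⟨γ₀, hγ₀, rfl, hl⟩ := hO
  obtain ⟨s, rfl⟩ := hp
  by_cases hs : γ₀ s ∈ saddles
  · obtain ⟨h1, h2⟩ := sin_eq_zero_of_mem_saddles hs
    have hconst : IsSolution cosPotential cosPotential (fun _ => γ₀ s) := by
      rw [isSolution_cosPotential_iff]
      intro t
      simp only [h1, h2, neg_zero]
      exact ⟨hasDerivAt_const _ _, hasDerivAt_const _ _⟩
    have := hγ₀.eq_of_eq hconst (t₀ := s) rfl
    exact not_isLeast_period_of_const (fun t => congrFun this t) τ hl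
  · have hsol := hγ₀.comp_add_const s
    obtain ⟨p, -, q, -, hpq, hp, hq⟩ :=
      tendsto_saddles hsol (by rwa [zero_add]) (by rwa [zero_add])
    have hper : Function.Periodic (fun t => γ₀ (t + s)) τ := fun t => by
      have := hl.1.2 (t + s)
      simp only
      rw [← this]; congr 1; ring
    -- Sampled at the times `± n τ` the solution is constant, so its two limits would coincide.
    have hn : Tendsto (fun n : ℕ => (n : ℝ) * τ) atTop atTop :=
      tendsto_natCast_atTop_atTop.atTop_mul_const hl.1.1
    have e1 : ∀ n : ℕ, γ₀ ((n : ℝ) * τ + s) = γ₀ (0 + s) := fun n => by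
      simpa using hper.nat_mul n 0
    have e2 : ∀ n : ℕ, γ₀ (-((n : ℝ) * τ) + s) = γ₀ (0 + s) := fun n => by
      have := hper.nat_mul n (-((n : ℝ) * τ))
      simp only [neg_add_cancel] at this
      exact this.symm
    have l1 := hq.comp hn
    have l2 := hp.comp (tendsto_neg_atTop_atBot.comp hn)
    simp only [Function.comp_def, e1, e2] at l1 l2
    exact hpq (tendsto_nhds_unique l2 l1)

/-! ### The period annulus and the period function -/

/-- A connected filled set contains the origin, so leaving the square would put one of its points on
the frontier, and that point would lie on a periodic orbit. -/
theorem periodAnnulus_cosPotential : periodAnnulus cosPotential cosPotential = openDiamond := by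
  refine Subset.antisymm (sUnion_subset fun U hU => ?_)
    (subset_sUnion_of_mem isFilledNeighborhood_openDiamond)
  obtain ⟨-, hconn, h0, hfill⟩ := hU
  refine hconn.isPreconnected.subset_of_closure_inter_subset isOpen_openDiamond
    ⟨_, h0, zero_mem_openDiamond⟩ fun p ⟨hpc, hpU⟩ => ?_
  by_contra hpn
  have hf : p ∈ frontier openDiamond := by
    rw [isOpen_openDiamond.frontier_eq]; exact ⟨hpc, hpn⟩
  obtain ⟨O, τ, hO, hpO, -⟩ := hfill p hpU fun h => hpn (h ▸ zero_mem_openDiamond)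
  exact hO.notMem_frontier hpO hf

theorem image_hamiltonian_openDiamond :
    hamiltonian cosPotential cosPotential '' openDiamond = Ico 0 2 := by
  refine Subset.antisymm (image_subset_iff.2 fun p hp => hamiltonian_mem_Ico hp) fun E hE => ?_
  have hpi : arccos (1 - E) < π := by
    refine lt_of_le_of_ne (arccos_le_pi _) fun h => ?_
    rw [arccos_eq_pi] at h; linarith [hE.2]
  have h0 := arccos_nonneg (1 - E)
  -- On the `y`-axis the energy is `1 - cos y`.
  refine ⟨(0, arccos (1 - E)), ⟨⟨?_, ?_⟩, ?_, ?_⟩, ?_⟩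
  · simp only; linarith
  · simp only; linarith
  · simp only; linarith
  · simp only; linarith
  · rw [hamiltonian_cosPotential, cos_arccos (by linarith [hE.2]) (by linarith [hE.1]), cos_zero]
    ring

/-- Every competitor in the infimum meets the level orbit, hence shares its period. -/
theorem periodFunction_cosPotential {E : ℝ} (hE : E ∈ Ioo (0 : ℝ) 2) :
    periodFunction cosPotential cosPotential E
      = ellipticIntegral (1 - (1 - E / 2) ^ 2) (2 * π) := by
  have hlev := isPeriodicOrbit_level hE
  have hset : {τ : ℝ | ∃ O, IsPeriodicOrbit cosPotential cosPotential O τ ∧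
      O ⊆ periodAnnulus cosPotential cosPotential ∧
      ∀ p ∈ O, hamiltonian cosPotential cosPotential p = E}
      = {ellipticIntegral (1 - (1 - E / 2) ^ 2) (2 * π)} := by
    rw [periodAnnulus_cosPotential]
    refine eq_singleton_iff_unique_mem.2
      ⟨⟨_, hlev, inter_subset_left, fun p hp => hp.2⟩, fun τ ⟨O, hO, hsub, hH⟩ => ?_⟩
    refine hO.period_unique hlev ?_
    obtain ⟨γ, -, rfl, -⟩ := hO
    exact ⟨γ 0, mem_range_self 0, hsub (mem_range_self 0), hH _ (mem_range_self 0)⟩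
  rw [periodFunction, hset, csInf_singleton]

/-- Chain rule through `m = 1 - (1 - E / 2)²`, whose derivative `1 - E / 2` is positive on `(0, 2)`.
-/
theorem monotonicallyIncreasing_periodFunction :
    MonotonicallyIncreasing (periodFunction cosPotential cosPotential) 2 := by
  intro E hE
  obtain ⟨h0, h2⟩ := hE
  obtain ⟨d, hd, hder⟩ := hasDerivAt_ellipticIntegral_param (m := 1 - (1 - E / 2) ^ 2)
    (by nlinarith)
  have hm : HasDerivAt (fun E : ℝ => 1 - (1 - E / 2) ^ 2) (1 - E / 2) E := by
    refine ((((hasDerivAt_id E).div_const 2).const_sub 1).pow 2 |>.const_sub 1).congr_deriv ?_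
    simp only [id]; ring
  have hT := (HasDerivAt.comp (h₂ := fun μ => ellipticIntegral μ (2 * π)) E hder hm).congr_of_eventuallyEq
    (f₁ := periodFunction cosPotential cosPotential)
    (eventually_of_mem (Ioo_mem_nhds h0 h2) fun e he => periodFunction_cosPotential he)
  refine ⟨hT.differentiableAt, ?_⟩
  rw [hT.deriv]
  exact mul_nonneg hd (by linarith)

end SeparableHamiltonian

open SeparableHamiltonian in
theorem mainTheorem6 :
    -- the Hamiltonian and the system it generates
    (∀ x y : ℝ, hamiltonian cosPotential cosPotential (x, y) = 2 - Real.cos x - Real.cos y) ∧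
    (∀ γ : ℝ → ℝ × ℝ, IsSolution cosPotential cosPotential γ ↔
      ∀ t : ℝ, HasDerivAt (fun s => (γ s).1) (Real.sin (γ t).2) t ∧
        HasDerivAt (fun s => (γ s).2) (-Real.sin (γ t).1) t) ∧
    -- the origin is a nondegenerate center
    (deriv cosPotential 0 = 0 ∧ 0 < iteratedDeriv 2 cosPotential 0 ∧
      IsFilledNeighborhood cosPotential cosPotential
        (periodAnnulus cosPotential cosPotential)) ∧
    -- the period annulus has energies `[0, 2)` and is bounded by the energy level `2`,
    (hamiltonian cosPotential cosPotential '' periodAnnulus cosPotential cosPotential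
        = Set.Ico 0 2 ∧
      ∀ p ∈ frontier (periodAnnulus cosPotential cosPotential),
        hamiltonian cosPotential cosPotential p = 2) ∧
    -- which is formed there by the four saddles and orbits connecting them
    (saddles ⊆ frontier (periodAnnulus cosPotential cosPotential) ∧
      (∀ p ∈ saddles, deriv cosPotential p.1 = 0 ∧ deriv cosPotential p.2 = 0 ∧
        iteratedDeriv 2 cosPotential p.1 * iteratedDeriv 2 cosPotential p.2 < 0) ∧
      ∀ γ : ℝ → ℝ × ℝ, IsSolution cosPotential cosPotential γ →
        γ 0 ∈ frontier (periodAnnulus cosPotential cosPotential) → γ 0 ∉ saddles →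
        ∃ p ∈ saddles, ∃ q ∈ saddles, p ≠ q ∧
          Filter.Tendsto γ Filter.atBot (nhds p) ∧ Filter.Tendsto γ Filter.atTop (nhds q)) ∧
    -- the period function is well defined on `(0, 2)`
    (∀ E ∈ Set.Ioo (0 : ℝ) 2,
      IsPeriodicOrbit cosPotential cosPotential
        (periodAnnulus cosPotential cosPotential ∩
          {p | hamiltonian cosPotential cosPotential p = E})
        (periodFunction cosPotential cosPotential E)) ∧
    -- factorization of `M`
    (∀ x y : ℝ, criterion cosPotential cosPotential x y =
      4 * (1 - Real.cos y) * Real.sin (x / 2) ^ 4 * Real.sin (y / 2) ^ 2 * factorN x y) ∧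
    -- sign of `N` and of `M`
    (∀ x y : ℝ, (x, y) ∈ region cosPotential cosPotential 2 → 0 ≤ factorN x y) ∧
    (∀ x y : ℝ, (x, y) ∈ region cosPotential cosPotential 2 →
      0 ≤ criterion cosPotential cosPotential x y) ∧
    -- monotonicity of the period function
    MonotonicallyIncreasing (periodFunction cosPotential cosPotential) 2 := by
  rw [periodAnnulus_cosPotential]
  refine ⟨hamiltonian_cosPotential, isSolution_cosPotential_iff, ⟨?_, ?_,
    isFilledNeighborhood_openDiamond⟩, ⟨image_hamiltonian_openDiamond,
    fun _ => hamiltonian_eq_two_of_mem_frontier⟩, ⟨saddles_subset_frontier, fun p hp => ?_,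
    fun _ => tendsto_saddles⟩, fun E hE => ?_, criterion_cosPotential, fun _ _ => factorN_nonneg,
    fun _ _ => criterion_cosPotential_nonneg, monotonicallyIncreasing_periodFunction⟩
  · simp [deriv_cosPotential]
  · simp [iteratedDeriv_two_cosPotential]
  · rw [deriv_cosPotential, iteratedDeriv_two_cosPotential]
    refine ⟨(sin_eq_zero_of_mem_saddles hp).1, (sin_eq_zero_of_mem_saddles hp).2, ?_⟩
    rcases hp with rfl | rfl | rfl | rfl <;> simp
  · rw [periodFunction_cosPotential hE]
    exact isPeriodicOrbit_level hE
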